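/- For a complex $m\times n$ matrix $X$ let $\|X\|_c$ be the largest Euclidean norm of a column of $X$, let $\|X\|_\infty$ be its operator norm with respect to the Euclidean norms, and let $\mathbb T$ be the unit circle in $\mathbb C$. For a vector $\Lambda$ let $\Delta(\Lambda)$ be the diagonal matrix with diagonal $\Lambda$. For integers $n\ge 1$ and real $c$, let $\mathcal F_n(c)$ be the property: for every $m$ and every complex $m\times n$ matrix $X$ there are a natural number $l\le n^2$, a complex $m\times l$ matrix $C$ with $\|C\|_\infty\le c\,\|X\|_c$, a Euclidean unit vector $\Lambda\in\mathbb C^l$ with positive entries, and an $l\times n$ matrix $Z$ with all entries in $\mathbb T$, such that $X=C\,\Delta(\Lambda)\,Z$. (1) For each $n\ge1$ there is a smallest positive real $c_n$ such that $\mathcal F_n(c_n)$ holds, and $c_n\le\sqrt{4/\pi}$. Moreover $\sup_{n\ge 1}c_n=\sqrt{4/\pi}$. (2) Consequently the statement is equivalent, constant by constant, to Grothendieck's little inequality. Let $F_X:(\mathbb C^n,\|\cdot\|_\infty)\to(\mathbb C^m,\|\cdot\|_2)$ be the linear operator with matrix $X$, let $\|X\|_F$ be its operator norm, and let $\|X\|_{cbF}$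 be its completely bounded norm, i.e. the supremum, over all $p$ and all $p\times p$ complex matrices $a_1,\dots,a_n$ with $\|a_j\|_\infty\le1$, of the operator norm of the $mp\times p$ block column with blocks $\sum_j X_{(i,j)}a_j$, $1\le i\le m$. For every real $k>0$, the property $\mathcal F_n(\sqrt k)$ holds for all $n\ge1$ if and only if $$\|X\|_{cbF}\le\sqrt{k}\,\|X\|_F\quad\text{for all } m,n \text{ and all complex } m\times n \text{ matrices } X.$$ The smallest $k>0$ for which this inequality holds is $4/\pi$. -/

import Mathlib

/-- The column norm `‖X‖_c = max_j ‖X_j‖₂`: the largest Euclidean norm of a column of `X`. -/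
noncomputable def columnNorm {m n : ℕ} (X : Matrix (Fin m) (Fin n) ℂ) : ℝ :=
  ⨆ j : Fin n, ‖WithLp.toLp 2 (fun i : Fin m => X i j)‖

open scoped Matrix.Norms.L2Operator in
/-- The constant `c` is admissible for `n` columns: every complex matrix `X` with `n` columns
factors as `X = C Δ(Λ) Z` with inner size `l ≤ n²`, where the operator norm (for Euclidean norms)
of `C` is at most `c ‖X‖_c`, `Λ` is a Euclidean unit vector with positive entries, and the entries
of `Z` lie on the unit circle. -/
def HasColumnFactorization (n : ℕ) (c : ℝ) : Prop :=
  ∀ (m : ℕ) (X : Matrix (Fin m) (Fin n) ℂ),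
    ∃ l : ℕ, l ≤ n ^ 2 ∧
      ∃ (C : Matrix (Fin m) (Fin l) ℂ) (Λ : EuclideanSpace ℝ (Fin l))
        (Z : Matrix (Fin l) (Fin n) ℂ),
        ‖C‖ ≤ c * columnNorm X ∧
        ‖Λ‖ = 1 ∧ (∀ i, 0 < Λ i) ∧
        (∀ i j, ‖Z i j‖ = 1) ∧
        X = C * Matrix.diagonal (fun i => (Λ i : ℂ)) * Z

/-- The operator `F_X : (ℂⁿ, ‖·‖_∞) → (ℂᵐ, ‖·‖₂)` with matrix `X`. -/
noncomputable def opF {m n : ℕ} (X : Matrix (Fin m) (Fin n) ℂ) :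
    (Fin n → ℂ) →L[ℂ] EuclideanSpace ℂ (Fin m) :=
  LinearMap.toContinuousLinearMap
    ((WithLp.linearEquiv 2 ℂ (Fin m → ℂ)).symm.toLinearMap ∘ₗ X.mulVecLin)

/-- The `p`-th amplification of `F_X`, with `ℂᵐ` regarded as the column space `M_{m,1}(ℂ)`.
An element of `M_p(ℂⁿ)` is an `n`-tuple `a` of `p × p` matrices. Its image is the block column
with blocks `∑ j, X i j • a j`, an `mp × p` matrix. -/
def amplifyF {m n : ℕ} (X : Matrix (Fin m) (Fin n) ℂ) (p : ℕ)
    (a : Fin n → Matrix (Fin p) (Fin p) ℂ) : Matrix (Fin m × Fin p) (Fin p) ℂ :=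
  Matrix.of fun is t => (∑ j, X is.1 j • a j) is.2 t

open scoped Matrix.Norms.L2Operator ENNReal in
/-- The completely bounded norm `‖X‖_cbF` of `F_X`: the supremum over `p` of the norms of the
amplifications, where the norm of `(a_1, …, a_n)` in `M_p(ℂⁿ)` is `max_j ‖a_j‖` and all matrices
carry the operator norm. -/
noncomputable def cbNormF {m n : ℕ} (X : Matrix (Fin m) (Fin n) ℂ) : ℝ≥0∞ :=
  ⨆ (p : ℕ) (a : Fin n → Matrix (Fin p) (Fin p) ℂ) (_ : ∀ j, ‖a j‖ ≤ 1), ‖amplifyF X p a‖ₑ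

/-- Grothendieck's little inequality (complex case) with the constant `k`:
`‖X‖_cbF ≤ √k ‖X‖_F` for all complex matrices `X`, where `‖X‖_F` is the norm of `F_X`. -/
def LittleGrothendieckInequality (k : ℝ) : Prop :=
  ∀ (m n : ℕ) (X : Matrix (Fin m) (Fin n) ℂ),
    cbNormF X ≤ ENNReal.ofReal (Real.sqrt k) * ‖opF X‖ₑ

open MeasureTheory ProbabilityTheory

/-! ### Gaussian rounding of unit vectors to phases -/

section GaussianRounding

variable {ι : Type*} [Fintype ι]

/-! A factorization `X = C Δ(Λ) Z` amounts to a domination of the Gram matrix `X* X` by `(c ‖X‖_c)²`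
times a convex combination `R` of rank one matrices `z* z` with unimodular `z`: weights and vectors
of `R` give `Λ` and `Z`, and Douglas' lemma gives `C`. Carathéodory bounds the number of terms, and
compactness of the hull makes the best constant attained.

Upper bound: scale the columns into the unit ball, pad them to unit vectors `x j`, and let `z j` be
the phase of `⟨g, x j⟩` for Gaussian `g`. The mean of `z* z` lies in the hull and dominates `π / 4`
times the Gram matrix of the `x j` (`norm_sq_le_integral_norm_phase_sq`), so `c = √(4 / π)` always
works.

Factorizations with constant `√k` give the little Grothendieck inequality: apply them to the matrix
with columns `a j ξ`.

Lower bound: test the inequality on a matrix whose columns discretize a Gaussian vector of `ℂ^N`.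
This yields `E ‖g‖ ≤ √N √k √(π / 2)`, while `E ‖g‖` is asymptotically at least `√(2 N)`; hence `k ≥
4 / π`. The supremum of the `c_n` and the remaining implication of the equivalence follow from this
sharp bound. -/

lemma EuclideanSpace.real_inner_eq_re_complex_inner (x y : EuclideanSpace ℂ ι) :
    inner ℝ x y = (inner ℂ x y).re := by
  simp [PiLp.inner_apply]

lemma integrable_inner_stdGaussian (x : EuclideanSpace ℂ ι) :
    Integrable (fun g => inner ℂ x g) (stdGaussian (EuclideanSpace ℂ ι)) :=
  (IsGaussian.integrable_id (μ := stdGaussian (EuclideanSpace ℂ ι))).const_inner x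

/-- The characteristic function of the image at `t` is that of the Gaussian at `t • x`, which
depends only on `‖t • x‖ = ‖t‖`. -/
lemma map_inner_stdGaussian {x : EuclideanSpace ℂ ι} (hx : ‖x‖ = 1) :
    (stdGaussian (EuclideanSpace ℂ ι)).map (fun g => inner ℂ x g) = stdGaussian ℂ := by
  have hm : Measurable fun g : EuclideanSpace ℂ ι => inner ℂ x g :=
    (continuous_const.inner continuous_id).measurable
  have := Measure.isProbabilityMeasure_map (μ := stdGaussian (EuclideanSpace ℂ ι)) hm.aemeasurable
  apply Measure.ext_of_charFun
  ext t
  rw [charFun_stdGaussian, charFun_apply, integral_map hm.aemeasurable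
    (by fun_prop)]
  have h := charFun_stdGaussian (t • x)
  rw [charFun_apply, norm_smul, hx, mul_one] at h
  rw [← h]
  congr 1
  ext g
  rw [EuclideanSpace.real_inner_eq_re_complex_inner, inner_smul_right]
  simp only [Complex.inner]
  congr 3
  rw [← inner_conj_symm g x, ← Complex.conj_re]

/-- Fixes the normalization: real and imaginary parts each have variance 1, so the second absolute
moment is 2 and the first is `√(π / 2)`. -/
lemma stdGaussian_complex_eq :
    stdGaussian ℂ = (volume : Measure ℂ).withDensity
      (fun z => ENNReal.ofReal ((2 * Real.pi)⁻¹ * Real.exp (-(1 / 2) * ‖z‖ ^ (2 : ℝ)))) := by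
  have hc : (gaussianReal 0 1).prod (gaussianReal 0 1) = (volume : Measure (ℝ × ℝ)).withDensity
      (fun p => gaussianPDF 0 1 p.1 * gaussianPDF 0 1 p.2) := by
    rw [gaussianReal_of_var_ne_zero 0 one_ne_zero, prod_withDensity (by fun_prop) (by fun_prop)]
    rfl
  have h1 : stdGaussian ℂ = ((gaussianReal 0 1).prod (gaussianReal 0 1)).map
      Complex.measurableEquivRealProd.symm := by
    rw [stdGaussian_eq_map_pi_orthonormalBasis Complex.orthonormalBasisOneI,
      ← (measurePreserving_finTwoArrow (gaussianReal 0 1)).map_eq,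
      Measure.map_map (MeasurableEquiv.measurable _) (MeasurableEquiv.measurable _)]
    congr 1
    ext x
    simp [Fin.sum_univ_two, Complex.measurableEquivRealProd, MeasurableEquiv.finTwoArrow,
      Complex.ext_iff]
  rw [h1, hc]
  ext s hs
  rw [MeasurableEquiv.map_apply, withDensity_apply _ hs,
    withDensity_apply _ (Complex.measurableEquivRealProd.symm.measurable hs),
    ← Complex.volume_preserving_equiv_real_prod.symm.setLIntegral_comp_preimage_emb
      (MeasurableEquiv.measurableEmbedding _)]
  congr 1
  ext p
  rw [gaussianPDF, gaussianPDF, ← ENNReal.ofReal_mul (gaussianPDFReal_nonneg _ _ _)]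
  congr 1
  simp only [gaussianPDFReal, NNReal.coe_one, mul_one, sub_zero]
  have : ‖Complex.measurableEquivRealProd.symm p‖ ^ (2 : ℝ) = p.1 ^ 2 + p.2 ^ 2 := by
    rw [Real.rpow_two, ← Complex.normSq_eq_norm_sq]
    simp [Complex.measurableEquivRealProd, Complex.normSq_apply, sq]
  rw [this, mul_mul_mul_comm, ← Real.exp_add, ← mul_inv, Real.mul_self_sqrt (by positivity)]
  congr 2
  ring

lemma integral_norm_rpow_stdGaussian_complex {q : ℝ} (hq : 0 ≤ q) :
    ∫ z, ‖z‖ ^ q ∂(stdGaussian ℂ) = 2 ^ (q / 2) * Real.Gamma (q / 2 + 1) := by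
  rw [stdGaussian_complex_eq, integral_withDensity_eq_integral_toReal_smul (by fun_prop) (by simp)]
  have (z : ℂ) : (ENNReal.ofReal ((2 * Real.pi)⁻¹ * Real.exp (-(1 / 2) * ‖z‖ ^ (2 : ℝ)))).toReal •
      ‖z‖ ^ q = (2 * Real.pi)⁻¹ * (‖z‖ ^ q * Real.exp (-(1 / 2) * ‖z‖ ^ (2 : ℝ))) := by
    rw [ENNReal.toReal_ofReal (by positivity), smul_eq_mul]
    ring
  simp_rw [this]
  rw [integral_const_mul, Complex.integral_rpow_mul_exp_neg_mul_rpow one_le_two (by linarith)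
    (by norm_num)]
  have h2 : (q + 2) / 2 = q / 2 + 1 := by ring
  rw [neg_div, h2, one_div, Real.inv_rpow zero_le_two, Real.rpow_neg zero_le_two, inv_inv,
    Real.rpow_add two_pos, Real.rpow_one]
  field_simp

lemma integral_norm_inner_stdGaussian {x : EuclideanSpace ℂ ι} (hx : ‖x‖ = 1) :
    ∫ g, ‖inner ℂ x g‖ ∂(stdGaussian (EuclideanSpace ℂ ι)) = √(Real.pi / 2) := by
  have h := integral_norm_rpow_stdGaussian_complex zero_le_one
  simp only [Real.rpow_one] at h
  rw [← map_inner_stdGaussian hx, integral_map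
    (Continuous.aemeasurable (by fun_prop)) (by fun_prop)] at h
  rw [h, Real.Gamma_add_one (by norm_num), Real.Gamma_one_half_eq, ← Real.sqrt_eq_rpow,
    Real.sqrt_div' _ zero_le_two]
  have := Real.mul_self_sqrt zero_le_two
  field_simp
  linear_combination this

lemma integral_norm_inner_sq_stdGaussian (x : EuclideanSpace ℂ ι) :
    ∫ g, ‖inner ℂ x g‖ ^ 2 ∂(stdGaussian (EuclideanSpace ℂ ι)) = 2 * ‖x‖ ^ 2 := by
  rcases eq_or_ne x 0 with rfl | hx
  · simp
  have h := integral_norm_rpow_stdGaussian_complex zero_le_two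
  have hu : ‖((‖x‖ : ℂ)⁻¹ • x)‖ = 1 := by
    rw [norm_smul]; simp [hx]
  simp only [Real.rpow_two] at h
  rw [← map_inner_stdGaussian hu, integral_map
    (Continuous.aemeasurable (by fun_prop)) (by fun_prop)] at h
  have h3 : Real.Gamma (2 / 2 + 1) = 1 := by
    rw [div_self two_ne_zero, Real.Gamma_add_one one_ne_zero]; simp
  simp only [h3, inner_smul_left, norm_mul, mul_pow, integral_const_mul] at h
  have hx' : ‖x‖ ≠ 0 := norm_ne_zero_iff.mpr hx
  simp at h
  field_simp at h
  linarith

/-- The phase `a / |a|` of a complex number, with the phase of `0` being `1`. -/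
noncomputable def phase (a : ℂ) : ℂ := Complex.exp (a.arg * Complex.I)

@[simp] lemma norm_phase (a : ℂ) : ‖phase a‖ = 1 := Complex.norm_exp_ofReal_mul_I _

@[fun_prop] lemma measurable_phase : Measurable phase := by
  unfold phase; fun_prop

lemma conj_mul_phase (a : ℂ) : (starRingEnd ℂ) a * phase a = ‖a‖ := by
  have h1 : (‖a‖ : ℂ) * phase a = a := Complex.norm_mul_exp_arg_mul_I a
  have h2 : (starRingEnd ℂ) (phase a) * phase a = 1 := by
    rw [mul_comm, Complex.mul_conj, Complex.normSq_eq_norm_sq]; simp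
  conv_lhs => rw [← h1]
  rw [map_mul, Complex.conj_ofReal, ← h1, mul_assoc]
  simp only [h1]
  rw [h2, mul_one]

lemma integral_stdGaussian_comp_isometry {F : Type*} [NormedAddCommGroup F] [NormedSpace ℝ F]
    (R : EuclideanSpace ℂ ι ≃ₗᵢ[ℂ] EuclideanSpace ℂ ι) (f : EuclideanSpace ℂ ι → F) :
    ∫ g, f (R g) ∂(stdGaussian (EuclideanSpace ℂ ι)) =
      ∫ g, f g ∂(stdGaussian (EuclideanSpace ℂ ι)) := by
  let R' : EuclideanSpace ℂ ι ≃ₗᵢ[ℝ] EuclideanSpace ℂ ι :=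
    ⟨R.toLinearEquiv.restrictScalars ℝ, R.norm_map⟩
  conv_rhs => rw [← stdGaussian_map R']
  exact (integral_map_equiv R'.toHomeomorph.toMeasurableEquiv f).symm

lemma integrable_inner_mul_phase (x y : EuclideanSpace ℂ ι) :
    Integrable (fun g => inner ℂ y g * phase (inner ℂ g x)) (stdGaussian (EuclideanSpace ℂ ι)) := by
  refine (integrable_inner_stdGaussian y).mul_bdd (c := 1) ?_ (by simp)
  exact (measurable_phase.comp (by fun_prop)).aestronglyMeasurable

/-- Split `y` into its component along `x` and an orthogonal remainder `w`. The reflection `w ↦ -w`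
preserves the Gaussian and fixes `x`, so the `w` term is odd and integrates to 0; along `x` the
phase turns the inner product into its absolute value. -/
lemma integral_inner_mul_phase {x : EuclideanSpace ℂ ι} (hx : ‖x‖ = 1) (y : EuclideanSpace ℂ ι) :
    ∫ g, inner ℂ y g * phase (inner ℂ g x) ∂(stdGaussian (EuclideanSpace ℂ ι)) =
      √(Real.pi / 2) * inner ℂ y x := by
  set w := y - inner ℂ x y • x with hw
  have hxx : inner ℂ x x = (1 : ℂ) := by rw [inner_self_eq_norm_sq_to_K, hx]; simp
  have hwx : inner ℂ w x = (0 : ℂ) := by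
    rw [hw, inner_sub_left, inner_smul_left, hxx, inner_conj_symm]; simp
  have hzero : ∫ g, inner ℂ w g * phase (inner ℂ g x) ∂(stdGaussian (EuclideanSpace ℂ ι)) = 0 := by
    let R := (ℂ ∙ w)ᗮ.reflection
    have hRw : R w = -w :=
      Submodule.reflection_mem_subspace_orthogonal_precomplement_eq_neg
        (Submodule.mem_span_singleton_self w)
    have hRx : R x = x := Submodule.reflection_mem_subspace_eq_self
      (Submodule.mem_orthogonal_singleton_iff_inner_right.mpr hwx)
    have h := integral_stdGaussian_comp_isometry R
      (fun g => inner ℂ w g * phase (inner ℂ g x))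
    have h2 (g : EuclideanSpace ℂ ι) : inner ℂ w (R g) * phase (inner ℂ (R g) x) =
        -(inner ℂ w g * phase (inner ℂ g x)) := by
      conv_lhs => rw [show inner ℂ (R g) x = inner ℂ (R g) (R x) by rw [hRx], R.inner_map_map,
        ← neg_neg w, ← hRw, ← map_neg, R.inner_map_map]
      simp
    simp_rw [h2, integral_neg] at h
    exact self_eq_neg.mp h.symm
  have hdec (g : EuclideanSpace ℂ ι) : inner ℂ y g * phase (inner ℂ g x) =
      inner ℂ y x * (‖inner ℂ x g‖ : ℂ) + inner ℂ w g * phase (inner ℂ g x) := by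
    have h1 := conj_mul_phase (inner ℂ g x)
    rw [inner_conj_symm, norm_inner_symm] at h1
    rw [← h1, hw, inner_sub_left, inner_smul_left, inner_conj_symm]
    ring
  simp_rw [hdec]
  rw [integral_add _ (integrable_inner_mul_phase x w), hzero, add_zero, integral_const_mul,
    integral_complex_ofReal, integral_norm_inner_stdGaussian hx, mul_comm]
  exact (integrable_inner_stdGaussian x).norm.ofReal.const_mul _

/-- Gaussian rounding: replacing unit vectors by the phases of their inner products with a
Gaussian vector decreases no quadratic form by more than the factor `π / 4`. -/
lemma norm_sq_le_integral_norm_phase_sq {κ : Type*} [Fintype κ] {x : κ → EuclideanSpace ℂ ι}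
    (hx : ∀ j, ‖x j‖ = 1) (v : κ → ℂ) :
    Real.pi / 4 * ‖∑ j, v j • x j‖ ^ 2 ≤
      ∫ g, ‖∑ j, v j * phase (inner ℂ g (x j))‖ ^ 2 ∂(stdGaussian (EuclideanSpace ℂ ι)) := by
  set μ := stdGaussian (EuclideanSpace ℂ ι)
  set y := ∑ j, v j • x j with hy
  set c := √(Real.pi / 2) with hc
  set S : EuclideanSpace ℂ ι → ℂ := fun g => ∑ j, v j * phase (inner ℂ g (x j)) with hS
  have hc2 : c ^ 2 = Real.pi / 2 := Real.sq_sqrt (by positivity)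
  have hSm : Measurable S := by
    refine Finset.measurable_sum _ fun j _ => ?_
    exact (measurable_phase.comp (by fun_prop)).const_mul _
  have hSb (g) : ‖S g‖ ≤ ∑ j, ‖v j‖ :=
    (norm_sum_le _ _).trans (by simp)
  have hSi : Integrable (fun g => ‖S g‖ ^ 2) μ := by
    refine Integrable.of_bound (hSm.norm.pow_const 2).aestronglyMeasurable ((∑ j, ‖v j‖) ^ 2) ?_
    filter_upwards with g
    rw [Real.norm_of_nonneg (by positivity)]
    gcongr
    exact hSb g
  have hhi : Integrable (fun g => ‖inner ℂ y g‖ ^ 2) μ := by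
    have := ((IsGaussian.memLp_two_id (μ := μ)).const_inner (𝕜 := ℂ) y).norm.integrable_sq
    exact this
  have hterm (j : κ) : Integrable (fun g => inner ℂ y g * (v j * phase (inner ℂ g (x j)))) μ := by
    refine ((integrable_inner_mul_phase (x j) y).const_mul (v j)).congr (.of_forall fun g => ?_)
    ring
  have hcross : Integrable (fun g => inner ℂ y g * S g) μ := by
    simp only [hS, Finset.mul_sum]
    exact integrable_finsetSum _ fun j _ => hterm j
  have hcross' : ∫ g, inner ℂ y g * S g ∂μ = c * ‖y‖ ^ 2 := by
    simp only [hS, Finset.mul_sum]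
    rw [integral_finsetSum]
    · have (j : κ) : ∫ g, inner ℂ y g * (v j * phase (inner ℂ g (x j))) ∂μ =
          c * inner ℂ y (v j • x j) := by
        rw [inner_smul_right, mul_left_comm, ← integral_inner_mul_phase (hx j),
          ← integral_const_mul]
        congr 1
        ext g
        ring
      simp_rw [this]
      rw [← Finset.mul_sum, ← inner_sum, ← hy, inner_self_eq_norm_sq_to_K]
      simp
    · exact fun j _ => hterm j
  have hre : ∫ g, (inner ℂ y g * S g).re ∂μ = c * ‖y‖ ^ 2 := by
    have := integral_re hcross
    simp only [RCLike.re_to_complex] at this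
    rw [this, hcross', ← Complex.ofReal_pow, ← Complex.ofReal_mul, Complex.ofReal_re]
  -- The multiple `c / 2` is the optimal linear approximation of `S` in mean square: since `E |⟨y,
  -- g⟩|² = 2 ‖y‖²`, nonnegativity of the error gives `E |S|² ≥ c² / 2 * ‖y‖²`, and `c² / 2 = π /
  -- 4`.
  have hpt (g) : ‖S g - (c / 2 : ℝ) * inner ℂ g y‖ ^ 2 =
      ‖S g‖ ^ 2 - c * (inner ℂ y g * S g).re + c ^ 2 / 4 * ‖inner ℂ y g‖ ^ 2 := by
    rw [← inner_conj_symm g y, ← Complex.normSq_eq_norm_sq, ← Complex.normSq_eq_norm_sq,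
      ← Complex.normSq_eq_norm_sq]
    simp only [Complex.normSq_apply, Complex.sub_re, Complex.sub_im, Complex.mul_re, Complex.mul_im,
      Complex.ofReal_re, Complex.ofReal_im, Complex.conj_re, Complex.conj_im]
    ring
  have h0 : 0 ≤ ∫ g, ‖S g - (c / 2 : ℝ) * inner ℂ g y‖ ^ 2 ∂μ :=
    integral_nonneg fun g => by positivity
  simp_rw [hpt] at h0
  have hci : Integrable (fun g => c * (inner ℂ y g * S g).re) μ := hcross.re.const_mul c
  have hdi : Integrable (fun g => ‖S g‖ ^ 2 - c * (inner ℂ y g * S g).re) μ := hSi.sub hci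
  rw [integral_add hdi (hhi.const_mul _), integral_sub hSi hci, integral_const_mul, integral_const_mul, hre,
    integral_norm_inner_sq_stdGaussian] at h0
  have : c * (c * ‖y‖ ^ 2) = Real.pi / 2 * ‖y‖ ^ 2 := by rw [← hc2]; ring
  rw [this, hc2] at h0
  linarith

end GaussianRounding

/-! ### Auxiliary facts: the mean Gaussian norm and compactness of convex hulls -/

lemma memLp_sq_gaussianReal : MemLp (fun x : ℝ => x ^ 2) 2 (gaussianReal 0 1) := by
  have h := (memLp_id_gaussianReal (μ := 0) (v := 1) 4)
  rw [memLp_two_iff_integrable_sq (by fun_prop)]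
  have := h.integrable_norm_pow (by norm_num)
  simpa [← pow_mul, Even.pow_abs (show Even 4 by decide)] using this

/-- The norm of a standard Gaussian vector concentrates around the square root of the dimension. -/
lemma exists_le_integral_norm_stdGaussian : ∃ V : ℝ, ∀ (N : ℕ), 0 < N →
    √(2 * N) * (1 - V / N) ≤
      ∫ g, ‖g‖ ∂(stdGaussian (EuclideanSpace ℂ (Fin N))) := by
  refine ⟨Var[fun x : ℝ => x ^ 2; gaussianReal 0 1] / 4, fun N hN => ?_⟩
  set V := Var[fun x : ℝ => x ^ 2; gaussianReal 0 1]
  set E := EuclideanSpace ℂ (Fin N)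
  have hd : Module.finrank ℝ E = 2 * N := by
    rw [← Module.finrank_mul_finrank ℝ ℂ E]; simp [E]
  have hnorm (x : Fin (Module.finrank ℝ E) → ℝ) :
      ‖∑ i, x i • stdOrthonormalBasis ℝ E i‖ ^ 2 = ∑ i, x i ^ 2 := by
    rw [← (stdOrthonormalBasis ℝ E).sum_sq_norm_inner_right]
    simp [(stdOrthonormalBasis ℝ E).orthonormal.inner_right_fintype]
  have hvar : Var[fun g => ‖g‖ ^ 2; stdGaussian E] = 2 * N * V := by
    rw [stdGaussian, variance_map (by fun_prop) (Measurable.aemeasurable (by fun_prop))]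
    have : ((fun g : E => ‖g‖ ^ 2) ∘ fun x : Fin (Module.finrank ℝ E) → ℝ =>
        ∑ i, x i • stdOrthonormalBasis ℝ E i) =
        ∑ i, fun x : Fin (Module.finrank ℝ E) → ℝ => (x i) ^ 2 := by
      ext x; simp [hnorm]
    rw [this, variance_sum_pi (X := fun _ (x : ℝ) => x ^ 2) fun i => memLp_sq_gaussianReal]
    simp [hd, V]
  have hmean : ∫ g, ‖g‖ ^ 2 ∂(stdGaussian E) = 2 * N := by
    have (g : EuclideanSpace ℂ (Fin N)) : ‖g‖ ^ 2 = ∑ i, ‖inner ℂ (EuclideanSpace.single i (1 : ℂ)) g‖ ^ 2 := by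
      simp [EuclideanSpace.norm_sq_eq, EuclideanSpace.inner_single_left]
    simp_rw [this]
    rw [integral_finsetSum]
    · simp [E, integral_norm_inner_sq_stdGaussian, mul_comm]
    · intro i _
      exact ((IsGaussian.memLp_two_id (μ := stdGaussian E)).const_inner (𝕜 := ℂ) _).norm.integrable_sq
  have hL4 : MemLp (fun g : E => ‖g‖ ^ 2) 2 (stdGaussian E) := by
    have h := (IsGaussian.memLp_id (stdGaussian E) 4 (by simp))
    rw [memLp_two_iff_integrable_sq (by fun_prop)]
    have := h.integrable_norm_pow (by norm_num)
    simpa [← pow_mul] using this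
  have hi2 : Integrable (fun g : E => ‖g‖ ^ 2) (stdGaussian E) := hL4.integrable one_le_two
  have hi1 : Integrable (fun g : E => ‖g‖) (stdGaussian E) := IsGaussian.integrable_id.norm
  rw [variance_eq_integral (by fun_prop), hmean] at hvar
  have hi4 : Integrable (fun g : E => (‖g‖ ^ 2 - 2 * N) ^ 2) (stdGaussian E) :=
    (hL4.sub (memLp_const _)).integrable_sq
  set s := √(2 * (N : ℝ)) with hs
  have hN' : (0 : ℝ) < N := by exact_mod_cast hN
  have hs2 : s ^ 2 = 2 * N := Real.sq_sqrt (by positivity)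
  have hs0 : 0 < s := Real.sqrt_pos.mpr (by positivity)
  -- A quadratic minorant of the square root, tangent at `s²`. On integration the linear term
  -- vanishes and the quadratic one is a variance of order `N`, so the loss relative to `s` is of
  -- order `1 / N`.
  have hpt (g : E) : s + (‖g‖ ^ 2 - 2 * N) / (2 * s) - (‖g‖ ^ 2 - 2 * N) ^ 2 / (2 * s ^ 3)
      ≤ ‖g‖ := by
    rw [← hs2]
    have : ‖g‖ - (s + (‖g‖ ^ 2 - s ^ 2) / (2 * s) - (‖g‖ ^ 2 - s ^ 2) ^ 2 / (2 * s ^ 3)) =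
        ‖g‖ * (‖g‖ - s) ^ 2 * (‖g‖ + 2 * s) / (2 * s ^ 3) := by
      field_simp
      ring
    have h2 : 0 ≤ ‖g‖ * (‖g‖ - s) ^ 2 * (‖g‖ + 2 * s) / (2 * s ^ 3) := by positivity
    linarith
  have hj1 : Integrable (fun g : E => (‖g‖ ^ 2 - 2 * N) / (2 * s)) (stdGaussian E) :=
    (hi2.sub (integrable_const _)).div_const _
  have hj2 : Integrable (fun g : E => s + (‖g‖ ^ 2 - 2 * N) / (2 * s)) (stdGaussian E) :=
    (integrable_const s).add hj1
  have hj3 := hi4.div_const (2 * s ^ 3)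
  refine le_trans (le_of_eq ?_) (integral_mono (hj2.sub hj3) hi1 hpt)
  simp only [Pi.sub_apply]
  rw [integral_sub hj2 hj3, integral_add (integrable_const s) hj1, integral_div, integral_div, integral_sub hi2 (integrable_const _), hmean, hvar]
  simp only [integral_const, probReal_univ, smul_eq_mul, one_mul, sub_self, zero_div, add_zero]
  rw [show s ^ 3 = s * (2 * N) by rw [← hs2]; ring]
  field_simp
  rw [hs2]
  ring

/-- In finite dimension, the convex hull of a compact set is compact. -/
lemma IsCompact.isCompact_convexHull_of_finiteDimensional {V : Type*} [NormedAddCommGroup V]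
    [NormedSpace ℝ V] [FiniteDimensional ℝ V] {s : Set V} (hs : IsCompact s) :
    IsCompact (convexHull ℝ s) := by
  -- By Carathéodory the hull is a finite union of continuous images of a simplex times a power of
  -- `s`.
  have heq : convexHull ℝ s = ⋃ k ∈ Set.Iic (Module.finrank ℝ V + 1),
      (fun p : (Fin k → ℝ) × (Fin k → V) => ∑ i, p.1 i • p.2 i) ''
        (stdSimplex ℝ (Fin k) ×ˢ Set.univ.pi fun _ => s) := by
    ext x
    simp only [Set.mem_iUnion, Set.mem_image, Set.mem_prod, Set.mem_univ_pi, Prod.exists,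
      Set.mem_Iic, exists_prop]
    constructor
    · intro hx
      obtain ⟨ι, _, z, w, hz, hai, hw, hw1, rfl⟩ := eq_pos_convex_span_of_mem_convexHull hx
      refine ⟨Fintype.card ι, ?_, w ∘ (Fintype.equivFin ι).symm, z ∘ (Fintype.equivFin ι).symm,
        ⟨⟨fun i => (hw _).le, ?_⟩, fun i => hz ⟨_, rfl⟩⟩, ?_⟩
      · exact hai.card_le_finrank_succ.trans (by gcongr; exact Submodule.finrank_le _)
      · exact ((Fintype.equivFin ι).symm.sum_comp w).trans hw1
      · exact (Fintype.equivFin ι).symm.sum_comp fun i => w i • z i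
    · rintro ⟨k, -, w, z, ⟨⟨hw, hw1⟩, hz⟩, rfl⟩
      exact (convex_convexHull ℝ s).sum_mem (fun i _ => hw i) hw1
        fun i _ => subset_convexHull ℝ s (hz i)
  rw [heq]
  refine (Set.finite_Iic _).isCompact_biUnion fun k _ => ?_
  refine ((isCompact_stdSimplex ℝ (Fin k)).prod (isCompact_univ_pi fun _ => hs)).image ?_
  fun_prop

/-! ### The hull of unimodular rank one matrices -/

section UnimodularHull

variable {n : ℕ}

/-- A real encoding `Re + Im` of the Hermitian rank one matrix with entries `conj (z j) * z k`. -/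
noncomputable def rankOneCode (z : Fin n → ℂ) (p : Fin n × Fin n) : ℝ :=
  ((starRingEnd ℂ) (z p.1) * z p.2).re + ((starRingEnd ℂ) (z p.1) * z p.2).im

/-- Evaluation at `v` of the quadratic form of the Hermitian matrix with a given real encoding. -/
noncomputable def codeForm (v : Fin n → ℂ) : (Fin n × Fin n → ℝ) →L[ℝ] ℝ :=
  ∑ p : Fin n × Fin n, (((starRingEnd ℂ) (v p.1) * v p.2).re -
    ((starRingEnd ℂ) (v p.1) * v p.2).im) • ContinuousLinearMap.proj p

/-- A Hermitian matrix has symmetric real and antisymmetric imaginary part, so their sum loses no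
information and takes only `n²` real coordinates. Pairing `Re + Im` with `Re - Im` produces the
wanted real part plus mixed terms, which cancel by antisymmetry. -/
lemma codeForm_rankOneCode (v z : Fin n → ℂ) :
    codeForm v (rankOneCode z) = ‖∑ k, z k * v k‖ ^ 2 := by
  have h : ((‖∑ k, z k * v k‖ ^ 2 : ℝ) : ℂ) =
      ∑ j, ∑ k, (starRingEnd ℂ) (z j * v j) * (z k * v k) := by
    rw [Complex.ofReal_pow, ← Complex.conj_mul', map_sum, Finset.sum_mul_sum]
  have h' := congrArg Complex.re h
  rw [Complex.ofReal_re] at h'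
  have hanti : ∑ j, ∑ k, (((starRingEnd ℂ) (z j) * z k).im * ((starRingEnd ℂ) (v j) * v k).re -
      ((starRingEnd ℂ) (z j) * z k).re * ((starRingEnd ℂ) (v j) * v k).im) = 0 := by
    refine self_eq_neg.mp ?_
    conv_lhs => rw [Finset.sum_comm]
    simp_rw [← Finset.sum_neg_distrib]
    refine Finset.sum_congr rfl fun j _ => Finset.sum_congr rfl fun k _ => ?_
    simp
    ring
  rw [h', codeForm, sum_apply, Fintype.sum_prod_type, ← add_zero (Complex.re _),
    ← hanti, Complex.re_sum, ← Finset.sum_add_distrib]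
  refine Finset.sum_congr rfl fun j _ => ?_
  rw [Complex.re_sum, ← Finset.sum_add_distrib]
  refine Finset.sum_congr rfl fun k _ => ?_
  simp [rankOneCode]
  ring

variable (n) in
/-- The convex hull of the encodings of the rank one matrices given by unimodular vectors. -/
def unimodularHull : Set (Fin n × Fin n → ℝ) :=
  convexHull ℝ (rankOneCode '' {z : Fin n → ℂ | ∀ j, ‖z j‖ = 1})

lemma isCompact_unimodularHull : IsCompact (unimodularHull n) := by
  refine IsCompact.isCompact_convexHull_of_finiteDimensional (IsCompact.image ?_ ?_)
  · have : {z : Fin n → ℂ | ∀ j, ‖z j‖ = 1} = Set.univ.pi fun _ => Metric.sphere 0 1 := by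
      ext z; simp
    rw [this]
    exact isCompact_univ_pi fun _ => isCompact_sphere 0 1
  · unfold rankOneCode
    fun_prop

/-- Carathéodory's theorem for the unimodular hull, with the bound `n ^ 2` on the length. -/
lemma exists_eq_sum_of_mem_unimodularHull (hn : 0 < n) {R : Fin n × Fin n → ℝ}
    (hR : R ∈ unimodularHull n) :
    ∃ l ≤ n ^ 2, ∃ (w : Fin l → ℝ) (Z : Fin l → Fin n → ℂ), (∀ i, 0 < w i) ∧ ∑ i, w i = 1 ∧
      (∀ i j, ‖Z i j‖ = 1) ∧ R = ∑ i, w i • rankOneCode (Z i) := by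
  obtain ⟨ι, _, z, w, hz, hai, hw, hw1, rfl⟩ := eq_pos_convex_span_of_mem_convexHull hR
  choose Z hZ hZz using fun i => hz ⟨i, rfl⟩
  let e := (Fintype.equivFin ι).symm
  refine ⟨Fintype.card ι, ?_, w ∘ e, Z ∘ e, fun i => hw _, (e.sum_comp w).trans hw1,
    fun i j => hZ _ j, ?_⟩
  -- Diagonal entries of the codes are all 1, so the differences lie in a proper subspace; this
  -- saves the extra `+ 1` in Carathéodory's bound.
  · have hlt : Module.finrank ℝ (vectorSpan ℝ (Set.range z)) < n ^ 2 := by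
      let j : Fin n := ⟨0, hn⟩
      have hle : vectorSpan ℝ (Set.range z) ≤
          LinearMap.ker (LinearMap.proj (R := ℝ) (φ := fun _ : Fin n × Fin n => ℝ) (j, j)) := by
        have hdiag (i : ι) : z i (j, j) = 1 := by
          rw [← hZz, rankOneCode, Complex.conj_mul', hZ i j]
          simp
        rw [vectorSpan_def, Submodule.span_le]
        rintro _ ⟨_, ⟨i, rfl⟩, _, ⟨k, rfl⟩, rfl⟩
        simp [hdiag]
      have hne : vectorSpan ℝ (Set.range z) ≠ ⊤ := by
        intro htop
        rw [htop] at hle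
        have := hle (Submodule.mem_top (x := fun _ => (1 : ℝ)))
        simp at this
      calc _ < Module.finrank ℝ (Fin n × Fin n → ℝ) := Submodule.finrank_lt hne
        _ = n ^ 2 := by simp [sq]
    exact hai.card_le_finrank_succ.trans hlt
  · simp only [Function.comp_apply, hZz]
    exact (e.sum_comp fun i => w i • z i).symm

end UnimodularHull

/-! ### Factorization as domination of Gram matrices -/

section Factorization

open scoped Matrix.Norms.L2Operator

lemma Matrix.l2_opNorm_le_of_forall {m n : Type*} [Fintype m] [Fintype n] [DecidableEq n]
    {A : Matrix m n ℂ} {K : ℝ} (hK : 0 ≤ K)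
    (h : ∀ v : EuclideanSpace ℂ n, ‖WithLp.toLp 2 (A.mulVec v)‖ ≤ K * ‖v‖) : ‖A‖ ≤ K := by
  rw [Matrix.l2_opNorm_def]
  exact ContinuousLinearMap.opNorm_le_bound _ hK h

/-- Douglas' factorization lemma for matrices. -/
lemma Matrix.exists_factorization_of_norm_le {m n l : ℕ} {X : Matrix (Fin m) (Fin n) ℂ}
    {W : Matrix (Fin l) (Fin n) ℂ} {K : ℝ} (hK : 0 ≤ K)
    (h : ∀ v : Fin n → ℂ, ‖WithLp.toLp 2 (X.mulVec v)‖ ≤ K * ‖WithLp.toLp 2 (W.mulVec v)‖) :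
    ∃ C : Matrix (Fin m) (Fin l) ℂ, ‖C‖ ≤ K ∧ X = C * W := by
  let TX := Matrix.toEuclideanLin X
  let TW := Matrix.toEuclideanLin W
  have h' (v : EuclideanSpace ℂ (Fin n)) : ‖TX v‖ ≤ K * ‖TW v‖ := h v.ofLp
  obtain ⟨s, hs⟩ := TW.rangeRestrict.exists_rightInverse_of_surjective TW.range_rangeRestrict
  have hs' (w : LinearMap.range TW) : TW (s w) = w :=
    congrArg Subtype.val (LinearMap.congr_fun hs w)
  let T : EuclideanSpace ℂ (Fin l) →ₗ[ℂ] EuclideanSpace ℂ (Fin m) :=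
    TX ∘ₗ s ∘ₗ (LinearMap.range TW).orthogonalProjectionOnto.toLinearMap
  have hTW (v : EuclideanSpace ℂ (Fin n)) : T (TW v) = TX v := by
    have h1 : (LinearMap.range TW).orthogonalProjectionOnto (TW v) = ⟨TW v, v, rfl⟩ :=
      Submodule.orthogonalProjectionOnto_mem_subspace_eq_self (⟨TW v, v, rfl⟩ : LinearMap.range TW)
    have h2 : T (TW v) = TX (s ⟨TW v, v, rfl⟩) := by
      simp only [T, LinearMap.comp_apply, ContinuousLinearMap.coe_coe, h1]
    -- Two preimages of the same vector under `TW` differ by an element of its kernel, which the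
    -- inequality forces into the kernel of `TX`; hence the choice of `s` does not matter.
    have h3 := h' (s ⟨TW v, v, rfl⟩ - v)
    rw [map_sub, map_sub, hs', sub_self, norm_zero, mul_zero, norm_le_zero_iff, sub_eq_zero] at h3
    rw [h2, h3]
  refine ⟨Matrix.toEuclideanLin.symm T, ?_, ?_⟩
  · refine Matrix.l2_opNorm_le_of_forall hK fun y => ?_
    have h4 : WithLp.toLp 2 ((Matrix.toEuclideanLin.symm T).mulVec y) = T y :=
      LinearMap.congr_fun (Matrix.toEuclideanLin.apply_symm_apply T) y
    rw [h4]
    refine (h' _).trans (mul_le_mul_of_nonneg_left ?_ hK)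
    rw [LinearMap.comp_apply, hs']
    exact (LinearMap.range TW).norm_orthogonalProjectionOnto_apply_le y
  · refine Matrix.toEuclideanLin.injective (LinearMap.ext fun v => ?_)
    have h5 : Matrix.toEuclideanLin (Matrix.toEuclideanLin.symm T * W) =
        Matrix.toEuclideanLin (Matrix.toEuclideanLin.symm T) ∘ₗ TW :=
      Matrix.toLpLin_mul 2 2 2 _ W
    rw [h5, LinearEquiv.apply_symm_apply, LinearMap.comp_apply, hTW]

lemma columnNorm_nonneg {m n : ℕ} (X : Matrix (Fin m) (Fin n) ℂ) : 0 ≤ columnNorm X :=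
  Real.iSup_nonneg fun _ => norm_nonneg _

lemma norm_column_le_columnNorm {m n : ℕ} (X : Matrix (Fin m) (Fin n) ℂ) (j : Fin n) :
    ‖WithLp.toLp 2 (fun i : Fin m => X i j)‖ ≤ columnNorm X :=
  le_ciSup (f := fun j => ‖WithLp.toLp 2 (fun i : Fin m => X i j)‖) (Set.finite_range _).bddAbove j

lemma norm_diagonal_mul_mulVec_sq {n l : ℕ} (Λ : Fin l → ℝ) (Z : Matrix (Fin l) (Fin n) ℂ)
    (v : Fin n → ℂ) :
    ‖WithLp.toLp 2 ((Matrix.diagonal (fun i => (Λ i : ℂ)) * Z).mulVec v)‖ ^ 2 =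
      codeForm v (∑ i, Λ i ^ 2 • rankOneCode (Z i)) := by
  rw [EuclideanSpace.norm_sq_eq, map_sum]
  refine Finset.sum_congr rfl fun i _ => ?_
  rw [map_smul, codeForm_rankOneCode, ← Matrix.mulVec_mulVec, WithLp.ofLp_toLp,
    Matrix.mulVec_diagonal, norm_mul, mul_pow]
  simp [Matrix.mulVec, dotProduct]

/-- The Gram matrix of every `X` with `n` columns is dominated by `(c ‖X‖_c) ^ 2` times a convex
combination of unimodular rank one matrices. -/
def HasUnimodularDomination (n : ℕ) (c : ℝ) : Prop :=
  ∀ (m : ℕ) (X : Matrix (Fin m) (Fin n) ℂ), ∃ R ∈ unimodularHull n, ∀ v : Fin n → ℂ,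
    ‖WithLp.toLp 2 (X.mulVec v)‖ ^ 2 ≤ (c * columnNorm X) ^ 2 * codeForm v R

lemma HasColumnFactorization.hasUnimodularDomination {n : ℕ} {c : ℝ}
    (h : HasColumnFactorization n c) : HasUnimodularDomination n c := by
  intro m X
  obtain ⟨l, -, C, Λ, Z, hC, hΛ, -, hZ, hX⟩ := h m X
  refine ⟨∑ i, Λ i ^ 2 • rankOneCode (Z i), ?_, fun v => ?_⟩
  · refine (convex_convexHull ℝ _).sum_mem (fun i _ => sq_nonneg _) ?_
      fun i _ => subset_convexHull ℝ _ ⟨Z i, hZ i, rfl⟩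
    rw [← EuclideanSpace.real_norm_sq_eq, hΛ, one_pow]
  · rw [← norm_diagonal_mul_mulVec_sq (fun i => Λ i), ← mul_pow]
    gcongr
    conv_lhs => rw [hX, Matrix.mul_assoc, ← Matrix.mulVec_mulVec]
    exact (Matrix.l2_opNorm_mulVec C (WithLp.toLp 2 _)).trans
      (mul_le_mul_of_nonneg_right hC (norm_nonneg _))

/-- Carathéodory weights `w` and unimodular vectors of `R` provide `Λ = √w` and `Z`, and Douglas'
lemma provides `C`. The bound on `l` comes for free, which is why domination need not mention it. -/
lemma HasUnimodularDomination.hasColumnFactorization {n : ℕ} (hn : 0 < n) {c : ℝ} (hc : 0 ≤ c)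
    (h : HasUnimodularDomination n c) : HasColumnFactorization n c := by
  intro m X
  obtain ⟨R, hR, hXR⟩ := h m X
  obtain ⟨l, hl, w, Z, hw, hw1, hZ, rfl⟩ := exists_eq_sum_of_mem_unimodularHull hn hR
  have hK : 0 ≤ c * columnNorm X := mul_nonneg hc (columnNorm_nonneg X)
  have hsq : ∑ i, w i • rankOneCode (Z i) = ∑ i, √(w i) ^ 2 • rankOneCode (Z i) :=
    Finset.sum_congr rfl fun i _ => by rw [Real.sq_sqrt (hw i).le]
  obtain ⟨C, hC, hX⟩ := Matrix.exists_factorization_of_norm_le (X := X)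
    (W := Matrix.diagonal (fun i => ((√(w i) : ℝ) : ℂ)) * Matrix.of Z) hK fun v => by
      refine le_of_sq_le_sq ?_ (by positivity)
      rw [mul_pow, norm_diagonal_mul_mulVec_sq (fun i => √(w i))]
      exact hsq ▸ hXR v
  refine ⟨l, hl, C, WithLp.toLp 2 fun i => √(w i), Matrix.of Z, hC, ?_,
    fun i => Real.sqrt_pos.mpr (hw i), hZ, by rw [Matrix.mul_assoc]; exact hX⟩
  rw [← sq_eq_sq₀ (norm_nonneg _) zero_le_one, EuclideanSpace.real_norm_sq_eq, one_pow, ← hw1]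
  exact Finset.sum_congr rfl fun i _ => Real.sq_sqrt (hw i).le

lemma HasColumnFactorization.mono {n : ℕ} {c c' : ℝ} (hcc : c ≤ c')
    (h : HasColumnFactorization n c) : HasColumnFactorization n c' := by
  intro m X
  obtain ⟨l, hl, C, Λ, Z, hC, h⟩ := h m X
  exact ⟨l, hl, C, Λ, Z, hC.trans (by gcongr; exact columnNorm_nonneg X), h⟩

/-- Keeps the infimum of admissible constants away from 0. Test on the row of ones: `Δ(Λ) Z` sends a
basis vector to a vector of norm `‖Λ‖ = 1`, which `C` must send to 1. -/
lemma HasColumnFactorization.one_le {n : ℕ} (hn : 0 < n) {c : ℝ}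
    (h : HasColumnFactorization n c) : 1 ≤ c := by
  have : Nonempty (Fin n) := ⟨⟨0, hn⟩⟩
  let X : Matrix (Fin 1) (Fin n) ℂ := Matrix.of fun _ _ => 1
  have hcol : columnNorm X = 1 := by simp [columnNorm, X, EuclideanSpace.norm_eq]
  obtain ⟨l, -, C, Λ, Z, hC, hΛ, -, hZ, hX⟩ := h 1 X
  rw [hcol, mul_one] at hC
  refine le_trans ?_ hC
  let e : Fin n → ℂ := Pi.single ⟨0, hn⟩ 1
  have h1 := Matrix.l2_opNorm_mulVec C
    (WithLp.toLp 2 ((Matrix.diagonal (fun i => (Λ i : ℂ)) * Z).mulVec e))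
  have h2 : ‖WithLp.toLp 2 ((Matrix.diagonal (fun i => (Λ i : ℂ)) * Z).mulVec e)‖ = 1 := by
    rw [← hΛ, EuclideanSpace.norm_eq, EuclideanSpace.norm_eq]
    simp [e, hZ]
  rw [h2, mul_one, WithLp.ofLp_toLp, Matrix.mulVec_mulVec, ← Matrix.mul_assoc, ← hX] at h1
  refine le_trans (le_of_eq ?_) h1
  change 1 = ‖WithLp.toLp 2 (X.mulVec e)‖
  simp [EuclideanSpace.norm_eq, X, e]

/-- For each `X` the dominating matrices subconverge in the compact hull, and the inequality passes
to the limit. This makes the infimum of admissible constants a minimum. -/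
lemma HasUnimodularDomination.of_tendsto {n : ℕ} {c : ℕ → ℝ} {c₀ : ℝ}
    (hc : Filter.Tendsto c Filter.atTop (nhds c₀)) (h : ∀ k, HasUnimodularDomination n (c k)) :
    HasUnimodularDomination n c₀ := by
  intro m X
  choose R hR hXR using fun k => h k m X
  obtain ⟨R₀, hR₀, φ, hφ, hlim⟩ := isCompact_unimodularHull.tendsto_subseq hR
  refine ⟨R₀, hR₀, fun v => ?_⟩
  refine ge_of_tendsto' (x := Filter.atTop) ?_ fun k => hXR (φ k) v
  exact (((hc.comp hφ.tendsto_atTop).mul_const _).pow 2).mul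
    (((codeForm v).continuous.tendsto R₀).comp hlim)

lemma hasUnimodularDomination_sqrt_four_div_pi (n : ℕ) :
    HasUnimodularDomination n (√(4 / Real.pi)) := by
  intro m X
  set κ := columnNorm X
  have hκ : 0 ≤ κ := columnNorm_nonneg X
  have hcol (j : Fin n) : ∑ i, ‖X i j‖ ^ 2 ≤ κ ^ 2 := by
    have := norm_column_le_columnNorm X j
    rw [← sq_le_sq₀ (norm_nonneg _) hκ, EuclideanSpace.norm_sq_eq] at this
    exact this
  -- If `κ = 0` then `X = 0`, so the convention for division by zero is harmless.
  have hdiv (i : Fin m) (j : Fin n) : (κ : ℂ) * (X i j / κ) = X i j := by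
    rcases eq_or_ne κ 0 with h0 | h0
    · have h1 := (Finset.single_le_sum (f := fun i => ‖X i j‖ ^ 2) (fun i _ => sq_nonneg _)
        (Finset.mem_univ i)).trans (hcol j)
      have h2 : X i j = 0 := by
        rw [h0] at h1
        have h3 : ‖X i j‖ ^ 2 = 0 := le_antisymm (by simpa using h1) (sq_nonneg _)
        simpa using h3
      simp [h2]
    · exact mul_div_cancel₀ _ (by exact_mod_cast h0)
  -- Each scaled column is padded to length 1 in a coordinate of its own; the extra coordinates can
  -- only enlarge the quadratic form.
  let x (j : Fin n) : EuclideanSpace ℂ (Fin m ⊕ Fin n) := WithLp.toLp 2 (Sum.elim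
    (fun i => X i j / κ) (Pi.single j ((√(1 - ∑ i, ‖X i j / κ‖ ^ 2) : ℝ) : ℂ)))
  have hx (j : Fin n) : ‖x j‖ = 1 := by
    have h1 : ∑ i, ‖X i j / κ‖ ^ 2 ≤ 1 := by
      simp_rw [norm_div, div_pow, ← Finset.sum_div, Complex.norm_real, Real.norm_of_nonneg hκ]
      exact div_le_one_of_le₀ (hcol j) (sq_nonneg _)
    rw [← sq_eq_sq₀ (norm_nonneg _) zero_le_one, EuclideanSpace.norm_sq_eq, Fintype.sum_sum_type]
    have h2 : ∑ i : Fin n, ‖(x j) (Sum.inr i)‖ ^ 2 = 1 - ∑ i, ‖X i j / κ‖ ^ 2 := by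
      rw [Finset.sum_eq_single j]
      · simp only [x, Sum.elim_inr, Pi.single_eq_same, Complex.norm_real]
        rw [Real.norm_of_nonneg (Real.sqrt_nonneg _), Real.sq_sqrt (by linarith)]
      · intro i _ hij
        simp [x, hij]
      · simp
    rw [h2]
    simp [x]
  let E := EuclideanSpace ℂ (Fin m ⊕ Fin n)
  let z (g : E) (j : Fin n) : ℂ := phase (inner ℂ g (x j))
  have hzm (j : Fin n) : Measurable fun g => z g j := measurable_phase.comp (by fun_prop)
  have hzR (g : E) : rankOneCode (z g) ∈ unimodularHull n :=
    subset_convexHull ℝ _ ⟨z g, fun j => norm_phase _, rfl⟩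
  have hint : Integrable (fun g => rankOneCode (z g)) (stdGaussian E) := by
    obtain ⟨B, hB⟩ := isCompact_unimodularHull.isBounded.exists_norm_le (s := unimodularHull n)
    refine Integrable.of_bound (Measurable.aestronglyMeasurable ?_) B
      (.of_forall fun g => hB _ (hzR g))
    refine measurable_pi_lambda _ fun p => ?_
    have hm : Measurable fun g => (starRingEnd ℂ) (z g p.1) * z g p.2 :=
      (Complex.continuous_conj.measurable.comp (hzm p.1)).mul (hzm p.2)
    exact (Complex.measurable_re.comp hm).add (Complex.measurable_im.comp hm)
  refine ⟨∫ g, rankOneCode (z g) ∂(stdGaussian E), (convex_convexHull ℝ _).integral_mem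
    isCompact_unimodularHull.isClosed (.of_forall hzR) hint, fun v => ?_⟩
  rw [← ContinuousLinearMap.integral_comp_comm _ hint]
  simp_rw [codeForm_rankOneCode]
  have hmain := norm_sq_le_integral_norm_phase_sq hx v
  have hle : ‖WithLp.toLp 2 (X.mulVec v)‖ ^ 2 ≤ κ ^ 2 * ‖∑ j, v j • x j‖ ^ 2 := by
    rw [EuclideanSpace.norm_sq_eq, EuclideanSpace.norm_sq_eq, Fintype.sum_sum_type, mul_add,
      Finset.mul_sum]
    refine le_add_of_le_of_nonneg (Finset.sum_le_sum fun i _ => le_of_eq ?_) (by positivity)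
    have : X.mulVec v i = κ * (∑ j, v j • x j) (Sum.inl i) := by
      simp only [Matrix.mulVec, dotProduct, WithLp.ofLp_sum, WithLp.ofLp_smul, Finset.sum_apply,
        Pi.smul_apply, smul_eq_mul, Finset.mul_sum, x, Sum.elim_inl]
      refine Finset.sum_congr rfl fun j _ => ?_
      conv_lhs => rw [← hdiv i j]
      ring
    rw [WithLp.ofLp_toLp, this, norm_mul, mul_pow, Complex.norm_real, Real.norm_of_nonneg hκ]
  refine hle.trans ?_
  have hpi := Real.pi_pos
  rw [mul_pow, Real.sq_sqrt (by positivity)]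
  have h4 : ‖∑ j, v j • x j‖ ^ 2 ≤ 4 / Real.pi *
      ∫ g, ‖∑ j, v j * phase (inner ℂ g (x j))‖ ^ 2 ∂(stdGaussian E) := by
    rw [div_mul_eq_mul_div, le_div_iff₀ hpi]
    linarith
  calc _ ≤ κ ^ 2 * _ := mul_le_mul_of_nonneg_left h4 (sq_nonneg κ)
    _ = _ := by
      simp_rw [mul_comm (v _)]
      ring

lemma hasColumnFactorization_sqrt_four_div_pi {n : ℕ} (hn : 0 < n) :
    HasColumnFactorization n (√(4 / Real.pi)) :=
  (hasUnimodularDomination_sqrt_four_div_pi n).hasColumnFactorization hn (Real.sqrt_nonneg _)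

lemma isLeast_sInf_hasColumnFactorization {n : ℕ} (hn : 0 < n) :
    IsLeast {x : ℝ | 0 < x ∧ HasColumnFactorization n x}
      (sInf {x : ℝ | 0 < x ∧ HasColumnFactorization n x}) := by
  set S := {x : ℝ | 0 < x ∧ HasColumnFactorization n x}
  have hne : S.Nonempty :=
    ⟨_, Real.sqrt_pos.mpr (by positivity), hasColumnFactorization_sqrt_four_div_pi hn⟩
  have hbdd : BddBelow S := ⟨0, fun x hx => hx.1.le⟩
  have hpos : 0 < sInf S := zero_lt_one.trans_le (le_csInf hne fun x hx => hx.2.one_le hn)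
  obtain ⟨u, -, hu, huS⟩ := exists_seq_tendsto_sInf hne hbdd
  exact ⟨⟨hpos, (HasUnimodularDomination.of_tendsto hu fun k =>
    (huS k).2.hasUnimodularDomination).hasColumnFactorization hn hpos.le⟩,
    fun x hx => csInf_le hbdd hx⟩

end Factorization

/-! ### From factorizations to the little Grothendieck inequality -/

section LittleGrothendieck

open scoped Matrix.Norms.L2Operator

lemma opF_apply {m n : ℕ} (X : Matrix (Fin m) (Fin n) ℂ) (v : Fin n → ℂ) :
    opF X v = WithLp.toLp 2 (X.mulVec v) := rfl

lemma amplifyF_mulVec {m n p : ℕ} (X : Matrix (Fin m) (Fin n) ℂ)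
    (a : Fin n → Matrix (Fin p) (Fin p) ℂ) (ξ : Fin p → ℂ) (i : Fin m) (s : Fin p) :
    (amplifyF X p a).mulVec ξ (i, s) = ∑ j, X i j * (a j).mulVec ξ s := by
  simp only [amplifyF, Matrix.mulVec, dotProduct, Matrix.of_apply, Matrix.sum_apply,
    Matrix.smul_apply, smul_eq_mul, Finset.mul_sum, Finset.sum_mul]
  rw [Finset.sum_comm]
  simp_rw [mul_assoc]

/-- Factor the matrix `Y` with columns `a j ξ`, whose column norm is at most `‖ξ‖`. Block `i` of the
amplification applied to `ξ` becomes `C (u i)`, and `∑ ‖u i‖²` is the average of `‖F_X (Z r)‖²` with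
weights `Λ r ^ 2`, where each `Z r` has sup norm at most 1. -/
lemma HasColumnFactorization.norm_amplifyF_le {n : ℕ} (hn : 0 < n) {c : ℝ} (hc : 0 ≤ c)
    (h : HasColumnFactorization n c) {m p : ℕ} (X : Matrix (Fin m) (Fin n) ℂ)
    (a : Fin n → Matrix (Fin p) (Fin p) ℂ) (ha : ∀ j, ‖a j‖ ≤ 1) :
    ‖amplifyF X p a‖ ≤ c * ‖opF X‖ := by
  have : Nonempty (Fin n) := ⟨⟨0, hn⟩⟩
  refine Matrix.l2_opNorm_le_of_forall (by positivity) fun ξ => ?_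
  let Y : Matrix (Fin p) (Fin n) ℂ := Matrix.of fun s j => (a j).mulVec ξ s
  have hY : columnNorm Y ≤ ‖ξ‖ := ciSup_le fun j =>
    (Matrix.l2_opNorm_mulVec (a j) ξ).trans (mul_le_of_le_one_left (norm_nonneg _) (ha j))
  obtain ⟨l, -, C, Λ, Z, hC, hΛ, -, hZ, hYC⟩ := h p Y
  have hC' : ‖C‖ ≤ c * ‖ξ‖ := hC.trans (by gcongr)
  let u (i : Fin m) : EuclideanSpace ℂ (Fin l) :=
    WithLp.toLp 2 fun r => Λ r * (X.mulVec (Z r)) i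
  have hentry (i : Fin m) (s : Fin p) : (amplifyF X p a).mulVec ξ (i, s) = C.mulVec (u i) s := by
    rw [amplifyF_mulVec]
    have (j : Fin n) : (a j).mulVec ξ s = ∑ r, C s r * Λ r * Z r j := by
      have := congrFun (congrFun hYC s) j
      rw [Matrix.mul_apply] at this
      simpa [Y, Matrix.mul_diagonal] using this
    simp_rw [this]
    simp only [u, Matrix.mulVec, dotProduct, Finset.mul_sum]
    rw [Finset.sum_comm]
    refine Finset.sum_congr rfl fun r _ => Finset.sum_congr rfl fun j _ => ?_
    ring
  have hrow (i : Fin m) : ∑ s, ‖C.mulVec (u i) s‖ ^ 2 ≤ ‖C‖ ^ 2 * ‖u i‖ ^ 2 := by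
    have := Matrix.l2_opNorm_mulVec C (u i)
    rw [← sq_le_sq₀ (norm_nonneg _) (by positivity), EuclideanSpace.norm_sq_eq, mul_pow] at this
    exact this
  have hXZ (r : Fin l) : ∑ i, ‖X.mulVec (Z r) i‖ ^ 2 ≤ ‖opF X‖ ^ 2 := by
    have h1 := (opF X).le_opNorm (Z r)
    have h2 : ‖Z r‖ ≤ 1 := (pi_norm_le_iff_of_nonneg zero_le_one).mpr fun j => (hZ r j).le
    have h3 : ‖opF X (Z r)‖ ≤ ‖opF X‖ := h1.trans (mul_le_of_le_one_right (norm_nonneg _) h2)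
    rw [← sq_le_sq₀ (norm_nonneg _) (norm_nonneg _), EuclideanSpace.norm_sq_eq] at h3
    exact h3
  have hu : ∑ i, ‖u i‖ ^ 2 ≤ ‖opF X‖ ^ 2 := by
    calc ∑ i, ‖u i‖ ^ 2 = ∑ r, Λ r ^ 2 * ∑ i, ‖X.mulVec (Z r) i‖ ^ 2 := by
          simp_rw [EuclideanSpace.norm_sq_eq, Finset.mul_sum]
          rw [Finset.sum_comm]
          simp [u, mul_pow]
      _ ≤ ∑ r, Λ r ^ 2 * ‖opF X‖ ^ 2 := by
          gcongr with r
          exact hXZ r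
      _ = ‖opF X‖ ^ 2 := by
          rw [← Finset.sum_mul, ← EuclideanSpace.real_norm_sq_eq, hΛ, one_pow, one_mul]
  refine le_of_sq_le_sq ?_ (by positivity)
  calc ‖WithLp.toLp 2 ((amplifyF X p a).mulVec ξ)‖ ^ 2
      = ∑ i, ∑ s, ‖C.mulVec (u i) s‖ ^ 2 := by
        rw [EuclideanSpace.norm_sq_eq, Fintype.sum_prod_type]
        exact Finset.sum_congr rfl fun i _ => Finset.sum_congr rfl fun s _ =>
          congrArg (fun z : ℂ => ‖z‖ ^ 2) (hentry i s)
    _ ≤ ∑ i, ‖C‖ ^ 2 * ‖u i‖ ^ 2 := Finset.sum_le_sum fun i _ => hrow i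
    _ ≤ (c * ‖ξ‖) ^ 2 * ‖opF X‖ ^ 2 := by
        rw [← Finset.mul_sum]
        exact mul_le_mul (pow_le_pow_left₀ (norm_nonneg _) hC' 2) hu
          (Finset.sum_nonneg fun i _ => sq_nonneg _) (sq_nonneg _)
    _ = (c * ‖opF X‖ * ‖ξ‖) ^ 2 := by ring

lemma littleGrothendieckInequality_of_hasColumnFactorization {k : ℝ}
    (h : ∀ n : ℕ+, HasColumnFactorization n (√k)) : LittleGrothendieckInequality k := by
  intro m n X
  refine iSup_le fun p => iSup_le fun a => iSup_le fun ha => ?_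
  rw [← ofReal_norm, ← ofReal_norm, ← ENNReal.ofReal_mul (Real.sqrt_nonneg _)]
  refine ENNReal.ofReal_le_ofReal ?_
  -- The factorization is available only for `n ≥ 1`; without columns the amplification vanishes.
  rcases Nat.eq_zero_or_pos n with rfl | hn
  · have : amplifyF X p a = 0 := by
      ext is t
      simp [amplifyF]
    rw [this, norm_zero]
    positivity
  · exact (h ⟨n, hn⟩).norm_amplifyF_le hn (Real.sqrt_nonneg _) X a ha

/-! ### Sharpness: the inequality forces `k ≥ 4 / π` -/

lemma LittleGrothendieckInequality.norm_amplifyF_le {k : ℝ} (h : LittleGrothendieckInequality k)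
    {m n p : ℕ} (X : Matrix (Fin m) (Fin n) ℂ)
    (a : Fin n → Matrix (Fin p) (Fin p) ℂ) (ha : ∀ j, ‖a j‖ ≤ 1) :
    ‖amplifyF X p a‖ ≤ √k * ‖opF X‖ := by
  have h1 : ‖amplifyF X p a‖ₑ ≤ cbNormF X :=
    le_iSup_of_le p (le_iSup_of_le a (le_iSup_of_le ha le_rfl))
  have h2 := h1.trans (h m n X)
  rw [← ofReal_norm, ← ofReal_norm, ← ENNReal.ofReal_mul (Real.sqrt_nonneg _)] at h2
  exact (ENNReal.ofReal_le_ofReal_iff (by positivity)).mp h2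

/-- The inequality tested on the matrix with weighted columns `w j • y j`. -/
lemma LittleGrothendieckInequality.sum_mul_norm_le {k : ℝ} (h : LittleGrothendieckInequality k)
    {n N : ℕ} (hN : 0 < N) (w : Fin n → ℝ) (y : Fin n → EuclideanSpace ℂ (Fin N))
    (hw : ∀ j, 0 ≤ w j) {B : ℝ} (hB : 0 ≤ B)
    (hy : ∀ u : EuclideanSpace ℂ (Fin N), ∑ j, w j * ‖inner ℂ u (y j)‖ ≤ B * ‖u‖) :
    ∑ j, w j * ‖y j‖ ≤ √N * (√k * B) := by
  let X : Matrix (Fin N) (Fin n) ℂ := Matrix.of fun i j => w j * y j i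
  have hX : ‖opF X‖ ≤ B := by
    refine ContinuousLinearMap.opNorm_le_bound _ hB fun z => ?_
    set u := opF X z with hu
    have hu' : u = ∑ j, (z j * w j) • y j := by
      ext i
      simp only [hu, opF_apply, Matrix.mulVec, dotProduct, X, Matrix.of_apply, WithLp.ofLp_sum,
        WithLp.ofLp_smul, Finset.sum_apply, Pi.smul_apply, smul_eq_mul]
      exact Finset.sum_congr rfl fun j _ => by ring
    -- Duality: pairing `u = F_X z` with itself lets the weak bound `hy` control the operator norm.
    have h1 : ‖u‖ * ‖u‖ ≤ ‖z‖ * (B * ‖u‖) := by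
      calc ‖u‖ * ‖u‖ = ‖inner ℂ u u‖ := by rw [inner_self_eq_norm_sq_to_K]; simp [sq]
        _ = ‖∑ j, z j * w j * inner ℂ u (y j)‖ := by
            conv_lhs => arg 1; arg 3; rw [hu']
            simp_rw [inner_sum, inner_smul_right]
        _ ≤ ∑ j, ‖z‖ * (w j * ‖inner ℂ u (y j)‖) := by
            refine norm_sum_le_of_le _ fun j _ => ?_
            rw [norm_mul, norm_mul, Complex.norm_real, Real.norm_of_nonneg (hw j), mul_assoc]
            have := hw j
            gcongr
            exact norm_le_pi_norm z j
        _ ≤ ‖z‖ * (B * ‖u‖) := by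
            rw [← Finset.mul_sum]
            gcongr
            exact hy u
    rcases eq_or_lt_of_le (norm_nonneg u) with h0 | h0
    · rw [← h0]
      positivity
    · exact le_of_mul_le_mul_right (by linarith) h0
  let t₀ : Fin N := ⟨0, hN⟩
  -- A rank one contraction sending the basis vector at `t₀` to the normalized conjugate of `y j`,
  -- or to 0 when `y j = 0`.
  let a (j : Fin n) : Matrix (Fin N) (Fin N) ℂ :=
    Matrix.of fun s t => if t = t₀ then (starRingEnd ℂ) (y j s) / ‖y j‖ else 0
  have hmv (j : Fin n) (ξ : Fin N → ℂ) (s : Fin N) :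
      (a j).mulVec ξ s = (starRingEnd ℂ) (y j s) / ‖y j‖ * ξ t₀ := by
    simp [a, Matrix.mulVec, dotProduct]
  have ha (j : Fin n) : ‖a j‖ ≤ 1 := by
    refine Matrix.l2_opNorm_le_of_forall zero_le_one fun ξ => ?_
    rw [one_mul]
    refine le_of_sq_le_sq ?_ (norm_nonneg _)
    have hs (s : Fin N) : ‖(a j).mulVec ξ s‖ ^ 2 = ‖y j s‖ ^ 2 / ‖y j‖ ^ 2 * ‖ξ t₀‖ ^ 2 := by
      rw [hmv, norm_mul, norm_div, mul_pow, div_pow, RCLike.norm_conj, Complex.norm_real, norm_norm]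
    rw [EuclideanSpace.norm_sq_eq]
    refine (Finset.sum_congr rfl fun s _ => hs s).trans_le ?_
    rw [← Finset.sum_mul, ← Finset.sum_div, ← EuclideanSpace.norm_sq_eq]
    refine (mul_le_of_le_one_left (sq_nonneg _) (div_self_le_one _)).trans ?_
    gcongr
    exact PiLp.norm_apply_le ξ t₀
  let e : EuclideanSpace ℂ (Fin N) := EuclideanSpace.single t₀ 1
  set F : Fin N × Fin N → ℂ := (amplifyF X N a).mulVec e with hF
  have hFle : ‖WithLp.toLp 2 F‖ ≤ √k * B := by
    have h1 := Matrix.l2_opNorm_mulVec (amplifyF X N a) e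
    have h2 : ‖e‖ = 1 := by simp [e]
    rw [h2, mul_one] at h1
    exact h1.trans ((h.norm_amplifyF_le X a ha).trans (by gcongr))
  -- Viewed as an `N × N` matrix, `F` is a sum of the `y j ⊗ conj (y j)` weighted by `w j / ‖y j‖`.
  -- Its trace is the wanted sum, and Cauchy–Schwarz on the diagonal costs the factor `√N`.
  have htrace : ∑ i, F (i, i) = (∑ j, w j * ‖y j‖ : ℝ) := by
    simp_rw [hF, amplifyF_mulVec, hmv]
    rw [Finset.sum_comm, Complex.ofReal_sum]
    refine Finset.sum_congr rfl fun j _ => ?_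
    have h1 : ∑ i, y j i * (starRingEnd ℂ) (y j i) = (‖y j‖ : ℂ) ^ 2 := by
      rw [← Complex.ofReal_pow, EuclideanSpace.norm_sq_eq, Complex.ofReal_sum]
      exact Finset.sum_congr rfl fun i _ => by rw [Complex.mul_conj']; simp
    calc _ = ∑ i, w j * (y j i * (starRingEnd ℂ) (y j i)) / ‖y j‖ :=
          Finset.sum_congr rfl fun i _ => by simp [X, e]; ring
      _ = w j * (‖y j‖ : ℂ) ^ 2 / ‖y j‖ := by rw [← Finset.sum_div, ← Finset.mul_sum, h1]
      _ = _ := by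
        rcases eq_or_ne (‖y j‖ : ℂ) 0 with h0 | h0
        · simp [h0]
        · push_cast
          field_simp
  have hdiag : ∑ i, ‖F (i, i)‖ ^ 2 ≤ ‖WithLp.toLp 2 F‖ ^ 2 := by
    rw [EuclideanSpace.norm_sq_eq, Fintype.sum_prod_type]
    exact Finset.sum_le_sum fun i _ =>
      Finset.single_le_sum (f := fun s => ‖F (i, s)‖ ^ 2) (fun s _ => sq_nonneg _)
        (Finset.mem_univ i)
  have hsum : (∑ j, w j * ‖y j‖) ≤ ∑ i, ‖F (i, i)‖ := by
    refine le_trans (le_abs_self _) ?_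
    rw [← Real.norm_eq_abs, ← Complex.norm_real, ← htrace]
    exact norm_sum_le _ _
  have hcs : (∑ i, ‖F (i, i)‖) ^ 2 ≤ N * ∑ i, ‖F (i, i)‖ ^ 2 := by
    simpa using sq_sum_le_card_mul_sum_sq (s := Finset.univ) (f := fun i => ‖F (i, i)‖)
  refine hsum.trans ?_
  refine le_of_sq_le_sq ?_ (by positivity)
  rw [mul_pow, Real.sq_sqrt (Nat.cast_nonneg N)]
  exact hcs.trans (by gcongr; exact hdiag.trans (by gcongr))

lemma integral_norm_inner_stdGaussian_eq {ι : Type*} [Fintype ι] (u : EuclideanSpace ℂ ι) :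
    ∫ g, ‖inner ℂ u g‖ ∂(stdGaussian (EuclideanSpace ℂ ι)) = √(Real.pi / 2) * ‖u‖ := by
  rcases eq_or_ne u 0 with rfl | hu
  · simp
  have hu' : (‖u‖ : ℂ) ≠ 0 := by exact_mod_cast norm_ne_zero_iff.mpr hu
  have h1 : ‖((‖u‖ : ℂ)⁻¹ • u)‖ = 1 := by
    rw [norm_smul]; simp [hu]
  rw [← integral_norm_inner_stdGaussian h1, mul_comm, ← integral_const_mul]
  refine integral_congr_ae (.of_forall fun g => ?_)
  have := norm_ne_zero_iff.mpr hu
  simp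
  field_simp

/-- Continuous version of the weighted sum estimate: approximate `g` in mean by a simple function
`f`, take its values as columns and the probabilities of its fibres as weights. -/
lemma LittleGrothendieckInequality.integral_norm_stdGaussian_le {k : ℝ}
    (h : LittleGrothendieckInequality k) {N : ℕ} (hN : 0 < N) :
    ∫ g, ‖g‖ ∂(stdGaussian (EuclideanSpace ℂ (Fin N))) ≤ √N * (√k * √(Real.pi / 2)) := by
  set μ := stdGaussian (EuclideanSpace ℂ (Fin N))
  have hid : Integrable (fun g : EuclideanSpace ℂ (Fin N) => g) μ := IsGaussian.integrable_id
  have key (δ : ℝ) (hδ : 0 < δ) : ∫ g, ‖g‖ ∂μ ≤ √N * (√k * (√(Real.pi / 2) + δ)) + δ := by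
    obtain ⟨f, hf, hfL⟩ := (memLp_one_iff_integrable.mpr hid).exists_simpleFunc_eLpNorm_sub_lt
      ENNReal.one_ne_top (ε := ENNReal.ofReal δ) (by simpa using hδ)
    have hfi : Integrable f μ := memLp_one_iff_integrable.mp hfL
    have hsub : Integrable (fun g => ‖g - f g‖) μ := (hid.sub hfi).norm
    have hδ' : ∫ g, ‖g - f g‖ ∂μ ≤ δ := by
      rw [eLpNorm_one_eq_lintegral_enorm] at hf
      refine (integral_norm_eq_lintegral_enorm (hid.sub hfi).aestronglyMeasurable).trans_le ?_
      exact ENNReal.toReal_le_of_le_ofReal hδ.le hf.le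
    let e := f.range.equivFin.symm
    have hsum (φ : EuclideanSpace ℂ (Fin N) → ℝ) (h0 : φ 0 = 0) :
        ∑ j, μ.real (f ⁻¹' {(e j : EuclideanSpace ℂ (Fin N))}) * φ (e j) = ∫ g, φ (f g) ∂μ := by
      have h1 := f.map_integral φ hfi h0
      rw [SimpleFunc.integral_eq_integral _ (SimpleFunc.integrable_of_isFiniteMeasure _)] at h1
      rw [e.sum_comp fun x : f.range => μ.real (f ⁻¹' {(x : EuclideanSpace ℂ (Fin N))}) * φ x]
      exact (Finset.sum_coe_sort f.range fun x => μ.real (f ⁻¹' {x}) * φ x).trans h1.symm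
    -- For exact Gaussian columns the weak bound would be `√(π / 2)`; replacing `g` by `f` costs at
    -- most `δ ‖u‖`.
    have hmain := h.sum_mul_norm_le hN (fun j => μ.real (f ⁻¹' {(e j : EuclideanSpace ℂ (Fin N))}))
      (fun j => e j) (fun j => measureReal_nonneg) (B := √(Real.pi / 2) + δ) (by positivity) ?_
    · rw [hsum _ norm_zero] at hmain
      have : ∫ g, ‖g‖ ∂μ ≤ ∫ g, ‖f g‖ ∂μ + ∫ g, ‖g - f g‖ ∂μ := by
        rw [← integral_add hfi.norm hsub]
        refine integral_mono hid.norm (hfi.norm.add hsub) fun g => ?_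
        have := norm_add_le (f g) (g - f g)
        rwa [add_sub_cancel] at this
      linarith
    · intro u
      rw [hsum (fun x => ‖inner ℂ u x‖) (by simp), add_mul, ← integral_norm_inner_stdGaussian_eq]
      have h1 : Integrable (fun g => ‖inner ℂ u g‖) μ := (integrable_inner_stdGaussian u).norm
      have h2 : Integrable (fun g => ‖inner ℂ u (f g)‖) μ := (hfi.const_inner u).norm
      have h3 : ∫ g, ‖inner ℂ u (f g)‖ ∂μ ≤
          ∫ g, ‖inner ℂ u g‖ ∂μ + ∫ g, ‖u‖ * ‖g - f g‖ ∂μ := by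
        rw [← integral_add h1 (hsub.const_mul _)]
        refine integral_mono h2 (h1.add (hsub.const_mul _)) fun g => ?_
        have h4 := norm_sub_le (inner ℂ u g) (inner ℂ u (g - f g))
        rw [← inner_sub_right, sub_sub_cancel] at h4
        exact h4.trans (by gcongr; exact norm_inner_le_norm _ _)
      rw [integral_const_mul] at h3
      have := mul_le_mul_of_nonneg_left hδ' (norm_nonneg u)
      linarith
  have hlim : Filter.Tendsto (fun δ : ℝ => √N * (√k * (√(Real.pi / 2) + δ)) + δ)
      (nhdsWithin 0 (Set.Ioi 0)) (nhds (√N * (√k * (√(Real.pi / 2) + 0)) + 0)) :=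
    (Continuous.tendsto (by fun_prop) 0).mono_left nhdsWithin_le_nhds
  rw [add_zero, add_zero] at hlim
  exact ge_of_tendsto hlim (by filter_upwards [self_mem_nhdsWithin] with δ hδ using key δ hδ)

lemma LittleGrothendieckInequality.four_div_pi_le {k : ℝ}
    (h : LittleGrothendieckInequality k) : 4 / Real.pi ≤ k := by
  obtain ⟨V, hV⟩ := exists_le_integral_norm_stdGaussian
  have hN (N : ℕ) (hN : 0 < N) : √2 * (1 - V / N) ≤ √k * √(Real.pi / 2) := by
    have h1 := (hV N hN).trans (h.integral_norm_stdGaussian_le hN)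
    rw [mul_comm 2, Real.sqrt_mul (Nat.cast_nonneg N), mul_assoc] at h1
    exact le_of_mul_le_mul_left h1 (Real.sqrt_pos.mpr (by exact_mod_cast hN))
  have hlim : Filter.Tendsto (fun N : ℕ => √2 * (1 - V / (N : ℝ))) Filter.atTop
      (nhds (√2 * (1 - 0))) :=
    (tendsto_const_nhds.sub (tendsto_const_div_atTop_nhds_zero_nat V)).const_mul _
  have h2 := le_of_tendsto hlim (Filter.eventually_atTop.mpr ⟨1, fun N h1 => hN N h1⟩)
  -- For `k ≤ 0` the real square root is 0 by convention, contradicting the limit bound by `√2`.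
  have hk : 0 < k := by
    by_contra hk
    rw [Real.sqrt_eq_zero_of_nonpos (not_lt.mp hk), zero_mul, sub_zero, mul_one] at h2
    exact absurd h2 (not_le.mpr (Real.sqrt_pos.mpr two_pos))
  rw [sub_zero, mul_one, ← Real.sqrt_mul hk.le] at h2
  have h3 := (Real.sqrt_le_sqrt_iff (by positivity)).mp h2
  rw [div_le_iff₀ Real.pi_pos]
  linarith

end LittleGrothendieck

theorem theorem2p2 :
    (∃ c : ℕ+ → ℝ,
      (∀ n : ℕ+, IsLeast {x : ℝ | 0 < x ∧ HasColumnFactorization n x} (c n) ∧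
        c n ≤ Real.sqrt (4 / Real.pi)) ∧
      IsLUB (Set.range c) (Real.sqrt (4 / Real.pi))) ∧
    (∀ k : ℝ, 0 < k →
      ((∀ n : ℕ+, HasColumnFactorization n (Real.sqrt k)) ↔ LittleGrothendieckInequality k)) ∧
    IsLeast {k : ℝ | 0 < k ∧ LittleGrothendieckInequality k} (4 / Real.pi) := by
  have hpi : 0 < 4 / Real.pi := by positivity
  have hF (n : ℕ+) : HasColumnFactorization n (√(4 / Real.pi)) :=
    hasColumnFactorization_sqrt_four_div_pi n.pos
  have hleast (n : ℕ+) := isLeast_sInf_hasColumnFactorization n.pos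
  have hle (n : ℕ+) : sInf {x : ℝ | 0 < x ∧ HasColumnFactorization n x} ≤ √(4 / Real.pi) :=
    (hleast n).2 ⟨Real.sqrt_pos.mpr hpi, hF n⟩
  refine ⟨⟨fun n => sInf {x : ℝ | 0 < x ∧ HasColumnFactorization n x},
    fun n => ⟨hleast n, hle n⟩, ?_, fun b hb => ?_⟩, fun k hk => ⟨fun h => ?_, fun h n => ?_⟩,
    ⟨hpi, littleGrothendieckInequality_of_hasColumnFactorization hF⟩, fun k hk => ?_⟩
  · rintro _ ⟨n, rfl⟩
    exact hle n
  · have hb' (n : ℕ+) : sInf {x : ℝ | 0 < x ∧ HasColumnFactorization n x} ≤ b := hb ⟨n, rfl⟩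
    have hb0 : 0 ≤ b := (hleast 1).1.1.le.trans (hb' 1)
    refine Real.sqrt_le_iff.mpr ⟨hb0, ?_⟩
    -- Any upper bound `b` of the minimal constants is admissible for all `n`, so the inequality
    -- holds with `k = b²`, and sharpness applies.
    refine (littleGrothendieckInequality_of_hasColumnFactorization fun n => ?_).four_div_pi_le
    rw [Real.sqrt_sq hb0]
    exact (hleast n).1.2.mono (hb' n)
  · exact littleGrothendieckInequality_of_hasColumnFactorization h
  -- No factorization is extracted from the inequality itself: it forces `k ≥ 4 / π`, and the
  -- factorization with `√(4 / π)` is then more than enough.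
  · exact (hF n).mono (Real.sqrt_le_sqrt h.four_div_pi_le)
  · exact hk.2.four_div_pi_le
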